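/- Let $m=(m_0,m_1,\dots)$ be any bounded sequence of integers $m_k\ge 2$. Let $G_m=\prod_{k}\mathbb Z/m_k\mathbb Z$ be the corresponding (bounded) Vilenkin group, equipped with the product $\mu$ of the uniform probability measures $\mu_k(\{j\})=1/m_k$ on the factors, and let $\mathcal F_n$ be the $\sigma$-algebra generated by the sets $I_n(x)=\{y\in G_m: y_0=x_0,\dots,y_{n-1}=x_{n-1}\}$, $x\in G_m$. Put $M_0=1$, $M_{k+1}=m_kM_k$, write $n\in\mathbb N$ uniquely as $n=\sum_j n_jM_j$ with $0\le n_j<m_j$, and let $\psi_n(x)=\prod_k \exp(2\pi i x_k/m_k)^{n_k}$ be the Vilenkin functions. For a complex-valued martingale $f=(f^{(n)})_{n\ge 0}$ with respect to $(\mathcal F_n)_{n\ge0}$ set $$\widehat f(i)=\lim_{k\to\infty}\int_{G_m} f^{(k)}\,\overline{\psi_i}\,d\mu,\qquad S_nf=\sum_{k=0}^{n-1}\widehat f(k)\psi_k,\qquad \sigma_nf=\frac1n\sum_{k=0}^{n-1}S_kf\quad(n\ge1),\qquad \sigma^*f=\sup_{n\ge1}|\sigma_nf| ,$$ and $\|g\|_{1/2}=\left(\int_{G_m}|g|^{1/2}\,d\mu\right)^{2}\in[0,\infty]$.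 The Hardy space $H_{1/2}(G_m)$ consists of the martingales $f$ with $\left\|\sup_n|f^{(n)}|\right\|_{1/2}<\infty$. Then there exists a martingale $f\in H_{1/2}(G_m)$ such that $\|\sigma^*f\|_{1/2}=+\infty$. -/

import Mathlib

open MeasureTheory Filter
open scoped ENNReal

noncomputable section

namespace Vilenkin

/-- The Vilenkin group `G_m`: the complete direct product of the cyclic groups `ℤ / m_k`, with the
product of the discrete topologies and the product σ-algebra. -/
abbrev VGroup (m : ℕ → ℕ) : Type := ∀ k, ZMod (m k)

/-- The product measure `μ` of the measures `μ_k({j}) = 1 / m_k`. -/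
def haar (m : ℕ → ℕ) : Measure (VGroup m) :=
  Measure.infinitePi fun k => (m k : ℝ≥0∞)⁻¹ • (Measure.count : Measure (ZMod (m k)))

/-- The interval `I_n(x)` of all `y` with `y_0 = x_0, …, y_{n-1} = x_{n-1}`. -/
def interval (m : ℕ → ℕ) (n : ℕ) (x : VGroup m) : Set (VGroup m) :=
  {y | ∀ k < n, y k = x k}

/-- The σ-algebra `F_n` generated by the intervals `I_n(x)`. -/
@[reducible] def sigmaAlgebra (m : ℕ → ℕ) (n : ℕ) : MeasurableSpace (VGroup m) :=
  MeasurableSpace.generateFrom (Set.range (interval m n))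

theorem countable_zmod (n : ℕ) : Countable (ZMod n) := by
  cases n with
  | zero => exact inferInstanceAs (Countable ℤ)
  | succ n => exact inferInstanceAs (Countable (Fin (n + 1)))

theorem countable_range_interval (m : ℕ → ℕ) (n : ℕ) : (Set.range (interval m n)).Countable := by
  have : ∀ k, Countable (ZMod (m k)) := fun k => countable_zmod (m k)
  refine (Set.countable_range
    (fun z : (∀ k : Fin n, ZMod (m k)) => {y : VGroup m | ∀ k : Fin n, y k = z k})).mono ?_
  rintro _ ⟨x, rfl⟩
  refine ⟨fun k => x k, ?_⟩
  ext y
  exact ⟨fun h k hk => h ⟨k, hk⟩, fun h k => h k k.2⟩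

theorem sigmaAlgebra_mono (m : ℕ → ℕ) : Monotone (sigmaAlgebra m) := by
  intro i j hij
  refine MeasurableSpace.generateFrom_le ?_
  rintro _ ⟨x, rfl⟩
  have h : interval m i x = ⋃₀ (interval m j '' interval m i x) := by
    ext y
    constructor
    · exact fun hy => ⟨interval m j y, ⟨y, hy, rfl⟩, fun _ _ => rfl⟩
    · rintro ⟨_, ⟨z, hz, rfl⟩, hy⟩ k hk
      exact (hy k (hk.trans_le hij)).trans (hz k hk)
  rw [h]
  refine @MeasurableSet.sUnion _ (sigmaAlgebra m j) _
    ((countable_range_interval m j).mono (Set.image_subset_range _ _)) ?_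
  rintro _ ⟨z, -, rfl⟩
  exact MeasurableSpace.measurableSet_generateFrom ⟨z, rfl⟩

theorem sigmaAlgebra_le (m : ℕ → ℕ) (n : ℕ) :
    sigmaAlgebra m n ≤ (inferInstance : MeasurableSpace (VGroup m)) := by
  refine MeasurableSpace.generateFrom_le ?_
  rintro _ ⟨x, rfl⟩
  have h : interval m n x = ⋂ k : Fin n, (fun y : VGroup m => y k) ⁻¹' {x k} := by
    ext y
    simp only [interval, Set.mem_ofPred_eq, Set.mem_iInter, Set.mem_preimage, Set.mem_singleton_iff]
    exact ⟨fun h k => h k k.2, fun h k hk => h ⟨k, hk⟩⟩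
  rw [h]
  exact MeasurableSet.iInter fun k => measurable_pi_apply _ (measurableSet_singleton _)

/-- The filtration `(F_n)`. -/
def filtration (m : ℕ → ℕ) :
    Filtration ℕ (inferInstance : MeasurableSpace (VGroup m)) where
  seq := sigmaAlgebra m
  mono' := sigmaAlgebra_mono m
  le' := sigmaAlgebra_le m

/-- The generalized powers `M_0 = 1`, `M_{k+1} = m_k M_k`. -/
def M (m : ℕ → ℕ) : ℕ → ℕ
  | 0 => 1
  | k + 1 => m k * M m k

/-- The `j`-th digit `n_j ∈ {0, …, m_j - 1}` in the expansion `n = ∑ j, n_j M_j`. -/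
def digit (m : ℕ → ℕ) (n j : ℕ) : ℕ := n / M m j % m j

/-- The generalized Rademacher function `r_k(x) = exp (2 π i x_k / m_k)`. -/
def rademacher (m : ℕ → ℕ) (k : ℕ) (x : VGroup m) : ℂ :=
  Complex.exp (2 * Real.pi * Complex.I * ((x k).val : ℂ) / (m k : ℂ))

/-- The Vilenkin function `ψ_n(x) = ∏ k, r_k(x) ^ n_k`; only finitely many factors have a
non-zero exponent. -/
def psi (m : ℕ → ℕ) (n : ℕ) (x : VGroup m) : ℂ :=
  ∏ᶠ k, rademacher m k x ^ digit m n k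

/-- The `i`-th Vilenkin-Fourier coefficient `lim_k ∫ f^(k) conj(ψ_i) dμ` of a martingale `f`. -/
def vilenkinCoeff (m : ℕ → ℕ) (f : ℕ → VGroup m → ℂ) (i : ℕ) : ℂ :=
  limUnder atTop fun k => ∫ x, f k x * (starRingEnd ℂ) (psi m i x) ∂haar m

/-- The partial sum `S_n f = ∑_{k < n} f̂(k) ψ_k` of the Vilenkin-Fourier series. -/
def partialSum (m : ℕ → ℕ) (f : ℕ → VGroup m → ℂ) (n : ℕ) (x : VGroup m) : ℂ :=
  ∑ k ∈ Finset.range n, vilenkinCoeff m f k * psi m k x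

/-- The Fejér mean `σ_n f = (1 / n) ∑_{k < n} S_k f`, for `n ≥ 1`. -/
def fejer (m : ℕ → ℕ) (f : ℕ → VGroup m → ℂ) (n : ℕ) (x : VGroup m) : ℂ :=
  1 / (n : ℂ) * ∑ k ∈ Finset.range n, partialSum m f k x

/-- The maximal Fejér operator `σ^* f = sup_{n ≥ 1} |σ_n f|`, with values in `[0, ∞]`. -/
def maximalFejer (m : ℕ → ℕ) (f : ℕ → VGroup m → ℂ) (x : VGroup m) : ℝ≥0∞ :=
  ⨆ (n : ℕ) (_ : 1 ≤ n), ‖fejer m f n x‖ₑ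

/-- The maximal function `f^* = sup_n |f^(n)|` of a martingale, with values in `[0, ∞]`. -/
def maximalFunction (m : ℕ → ℕ) (f : ℕ → VGroup m → ℂ) (x : VGroup m) : ℝ≥0∞ :=
  ⨆ n : ℕ, ‖f n x‖ₑ

/-- `f` belongs to the martingale Hardy space `H_p(G_m)`: it is a martingale with respect to
`(F_n)` and its maximal function has finite `L_p` (quasi-)norm `(∫ (f^*)^p dμ)^(1/p)`. -/
def MemHardy (m : ℕ → ℕ) (p : ℝ≥0∞) (f : ℕ → VGroup m → ℂ) : Prop :=
  Martingale f (filtration m) (haar m) ∧ eLpNorm (maximalFunction m f) p (haar m) < ∞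

end Vilenkin

end

namespace Vilenkin

/-! The counterexample is the formal sum of `w j ^ 2 * bump m j`, that is of `w_j² M_j² r_j
1_{I_j(0)}`, with a summable lacunary weight `w`. The square root of its maximal function is at most
`∑ w_j M_j 1_{I_j(0)}`, whose integral is `∑ w_j`; hence it lies in `H_{1/2}`
(`memHardy_bumpMartingale`).

The `j`-th bump has coefficient `M_j` at each frequency in `[M_j, 2 M_j)` and zero elsewhere
(`integral_bump_mul_conj_psi`). For `i < M_t` and `t ≤ N`, `ψ_{M_N + i}` equals `r_N` on `I_t(0)`,
so there is no cancellation: the partial sums past `M_N` grow linearly, and `σ_{M_N + M_t} f` has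
size at least `w_N² M_t² / 8` up to an error from lower bumps (`norm_fejer_ge`). After a square
root, each layer `I_t(0) \ I_{t+1}(0)`, of measure at least `1 / (2 M_t)`, contributes a multiple of
`w_N` independent of `t`. About `N` layers give `N w_N / 6` minus a lower-order term
(`lintegral_sqrt_maximalFejer_ge`). Sparse weights make this unbounded while `∑ w_j` converges
(`exists_lacunary_weights`). -/

/-! ### Integration against the product measure -/

theorem isProbabilityMeasure_uniform (n : ℕ) [NeZero n] :
    IsProbabilityMeasure ((n : ℝ≥0∞)⁻¹ • (Measure.count : Measure (ZMod n))) := by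
  constructor
  rw [Measure.smul_apply, Measure.count_apply_finite _ Set.finite_univ]
  simp [ENNReal.inv_mul_cancel, NeZero.ne n, ZMod.card]

theorem integral_uniform (n : ℕ) [NeZero n] (g : ZMod n → ℂ) :
    ∫ z, g z ∂((n : ℝ≥0∞)⁻¹ • (Measure.count : Measure (ZMod n))) = (n : ℂ)⁻¹ * ∑ z, g z := by
  rw [integral_smul_measure, integral_count]
  simp

variable {m : ℕ → ℕ}

theorem isProbabilityMeasure_haar [∀ k, NeZero (m k)] : IsProbabilityMeasure (haar m) := by
  have := fun k => isProbabilityMeasure_uniform (m k)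
  unfold haar
  infer_instance

theorem integral_prod_haar [∀ k, NeZero (m k)] (K : ℕ) (g : ∀ k, ZMod (m k) → ℂ) :
    ∫ x, ∏ k ∈ Finset.range K, g k (x k) ∂haar m =
      ∏ k ∈ Finset.range K, ((m k : ℂ)⁻¹ * ∑ z, g k z) := by
  have := fun k => isProbabilityMeasure_uniform (m k)
  have h := integral_restrict_infinitePi
    (μ := fun k => (m k : ℝ≥0∞)⁻¹ • (Measure.count : Measure (ZMod (m k))))
    (s := Finset.range K) (f := fun y => ∏ k : Finset.range K, g k (y k))
    (Measurable.aestronglyMeasurable (Finset.measurable_prod _ fun k _ =>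
      (measurable_of_countable (g k)).comp (measurable_pi_apply k)))
  rw [integral_fintype_prod_eq_prod (f := fun (k : Finset.range K) z => g k z)] at h
  simp only [integral_uniform] at h
  rw [Finset.prod_coe_sort (Finset.range K) fun k => ((m k : ℂ)⁻¹ * ∑ z, g k z)] at h
  rw [← h]
  refine integral_congr_ae (ae_of_all _ fun x => ?_)
  exact (Finset.prod_coe_sort (Finset.range K) fun k => g k (x k)).symm

/-! ### Generalized powers, intervals and atoms -/

theorem M_eq_prod (n : ℕ) : M m n = ∏ k ∈ Finset.range n, m k := by
  induction n with
  | zero => rfl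
  | succ n ih => rw [Finset.prod_range_succ, ← ih, M, mul_comm]

theorem M_pos [∀ k, NeZero (m k)] (n : ℕ) : 0 < M m n := by
  rw [M_eq_prod]
  exact Finset.prod_pos fun k _ => NeZero.pos _

theorem M_dvd {i j : ℕ} (h : i ≤ j) : M m i ∣ M m j := by
  rw [M_eq_prod, M_eq_prod]
  exact Finset.prod_dvd_prod_of_subset _ _ _ (Finset.range_mono h)

theorem M_mono [∀ k, NeZero (m k)] : Monotone (M m) := fun _ j h =>
  Nat.le_of_dvd (M_pos j) (M_dvd h)

theorem two_mul_M_le (hm : ∀ k, 2 ≤ m k) {i j : ℕ} (h : i < j) : 2 * M m i ≤ M m j := by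
  have : ∀ k, NeZero (m k) := fun k => ⟨by have := hm k; omega⟩
  calc 2 * M m i ≤ m i * M m i := Nat.mul_le_mul_right _ (hm i)
    _ = M m (i + 1) := rfl
    _ ≤ M m j := M_mono h

theorem lt_M (hm : ∀ k, 2 ≤ m k) (n : ℕ) : n < M m n := by
  induction n with
  | zero => simp [M]
  | succ n ih =>
    have := two_mul_M_le hm (Nat.lt_add_one n)
    omega

theorem haar_interval_zero [∀ k, NeZero (m k)] (n : ℕ) :
    haar m (interval m n 0) = (M m n : ℝ≥0∞)⁻¹ := by
  have := fun k => isProbabilityMeasure_uniform (m k)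
  have h : interval m n 0 = Set.pi (Finset.range n : Set ℕ) fun k => {(0 : ZMod (m k))} := by
    ext y
    simp [interval, Set.mem_pi]
  rw [h, haar, Measure.infinitePi_pi _ fun k _ => measurableSet_singleton _, M_eq_prod]
  simp only [Measure.smul_apply, Measure.count_singleton, smul_eq_mul, mul_one]
  rw [Nat.cast_prod, ENNReal.prod_inv_distrib]
  · intro i _ j _ _; simp

theorem measurableSet_interval (n : ℕ) (x : VGroup m) : MeasurableSet (interval m n x) :=
  sigmaAlgebra_le m n _ (MeasurableSpace.measurableSet_generateFrom ⟨x, rfl⟩)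

/-- A function of the first `n` coordinates is measurable with respect to `F_n`. -/
theorem measurable_of_forall_interval {E : Type*} [MeasurableSpace E] {n : ℕ} {g : VGroup m → E}
    (hg : ∀ x y, y ∈ interval m n x → g y = g x) : Measurable[sigmaAlgebra m n] g := by
  intro s _
  have h : g ⁻¹' s = ⋃₀ (interval m n '' (g ⁻¹' s)) := by
    ext y
    constructor
    · exact fun hy => ⟨interval m n y, ⟨y, hy, rfl⟩, fun _ _ => rfl⟩
    · rintro ⟨_, ⟨z, hz, rfl⟩, hy⟩
      rw [Set.mem_preimage, hg z y hy]
      exact hz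
  rw [h]
  refine @MeasurableSet.sUnion _ (sigmaAlgebra m n) _
    ((countable_range_interval m n).mono (Set.image_subset_range _ _)) ?_
  rintro _ ⟨z, -, rfl⟩
  exact MeasurableSpace.measurableSet_generateFrom ⟨z, rfl⟩

/-- The intervals `I_n(x)` are atoms of `F_n`. -/
theorem interval_subset_or_disjoint {n : ℕ} (x : VGroup m) {s : Set (VGroup m)}
    (hs : MeasurableSet[sigmaAlgebra m n] s) : interval m n x ⊆ s ∨ interval m n x ⊆ sᶜ := by
  induction s, hs using MeasurableSpace.generateFrom_induction with
  | hC s hs _ =>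
    obtain ⟨z, rfl⟩ := hs
    by_cases h : x ∈ interval m n z
    · exact Or.inl fun y hy k hk => (hy k hk).trans (h k hk)
    · exact Or.inr fun y hy hyz => h fun k hk => (hy k hk).symm.trans (hyz k hk)
  | empty => exact Or.inr (by simp)
  | compl s _ ih => rwa [compl_compl, or_comm]
  | iUnion s _ ih =>
    by_cases h : ∃ i, interval m n x ⊆ s i
    · obtain ⟨i, hi⟩ := h
      exact Or.inl (hi.trans (Set.subset_iUnion s i))
    · push Not at h
      rw [Set.compl_iUnion]
      exact Or.inr (Set.subset_iInter fun i => (ih i).resolve_left (h i))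

/-! ### Characters of the cyclic factors -/

/-- The character `z ↦ exp (2 π i z / n)` of `ℤ / n`. -/
noncomputable def character (n : ℕ) (z : ZMod n) : ℂ :=
  Complex.exp (2 * Real.pi * Complex.I * (z.val : ℂ) / (n : ℂ))

theorem rademacher_eq (k : ℕ) (x : VGroup m) : rademacher m k x = character (m k) (x k) := rfl

theorem character_zero (n : ℕ) : character n 0 = 1 := by
  simp [character, ZMod.val_zero]

theorem norm_character (n : ℕ) (z : ZMod n) : ‖character n z‖ = 1 := by
  have : 2 * Real.pi * Complex.I * (z.val : ℂ) / (n : ℂ) =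
      ((2 * Real.pi * z.val / n : ℝ) : ℂ) * Complex.I := by
    push_cast; ring
  rw [character, this, Complex.norm_exp_ofReal_mul_I]

theorem sum_character_pow {n a : ℕ} [NeZero n] (ha : a < n) :
    ∑ z : ZMod n, character n z ^ a = if a = 0 then (n : ℂ) else 0 := by
  split_ifs with h
  · simp [h, ZMod.card]
  set ζ := Complex.exp (2 * Real.pi * Complex.I / n) with hζ
  have hprim : IsPrimitiveRoot ζ n := Complex.isPrimitiveRoot_exp n (NeZero.ne n)
  have hchar : ∀ z : ZMod n, character n z ^ a = (ζ ^ a) ^ z.val := by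
    intro z
    rw [character, hζ, ← Complex.exp_nat_mul, ← Complex.exp_nat_mul, ← Complex.exp_nat_mul]
    congr 1
    ring
  have hsum : ∑ z : ZMod n, (ζ ^ a) ^ z.val = ∑ i ∈ Finset.range n, (ζ ^ a) ^ i := by
    obtain ⟨n, rfl⟩ := Nat.exists_eq_succ_of_ne_zero (NeZero.ne n)
    exact Fin.sum_univ_eq_sum_range (fun i => (ζ ^ a) ^ i) (n + 1)
  have hne : ζ ^ a ≠ 1 := hprim.pow_ne_one_of_pos_of_lt h ha
  simp only [hchar, hsum]
  rw [geom_sum_eq hne, ← pow_mul, mul_comm, pow_mul, hprim.pow_eq_one]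
  simp

/-- Since characters have modulus one, one conjugate factor cancels and the exponent drops to `a -
1`; for `a = 0` the sum of the character itself vanishes because `n ≥ 2`. -/
theorem sum_character_mul_conj {n a : ℕ} [NeZero n] (hn : 2 ≤ n) (ha : a < n) :
    ∑ z : ZMod n, character n z * (starRingEnd ℂ) (character n z ^ a) =
      if a = 1 then (n : ℂ) else 0 := by
  rcases a with _ | a
  · simpa using sum_character_pow (n := n) (a := 1) (by omega)
  · have h : ∀ z : ZMod n, character n z * (starRingEnd ℂ) (character n z ^ (a + 1)) =
        (starRingEnd ℂ) (character n z ^ a) := by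
      intro z
      rw [pow_succ', map_mul, ← mul_assoc, Complex.mul_conj, Complex.normSq_eq_norm_sq,
        norm_character]
      simp
    simp only [h]
    rw [← map_sum, sum_character_pow (by omega)]
    split_ifs <;> first | omega | simp

theorem sum_conj_character_pow {n a : ℕ} [NeZero n] (ha : a < n) :
    ∑ z : ZMod n, (starRingEnd ℂ) (character n z ^ a) = if a = 0 then (n : ℂ) else 0 := by
  rw [← map_sum, sum_character_pow ha]
  split_ifs <;> simp

/-! ### Digits and Vilenkin functions -/

theorem digit_lt [∀ k, NeZero (m k)] (n k : ℕ) : digit m n k < m k :=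
  Nat.mod_lt _ (NeZero.pos _)

theorem digit_eq_zero_of_lt {n k : ℕ} (h : n < M m k) : digit m n k = 0 := by
  rw [digit, Nat.div_eq_of_lt h, Nat.zero_mod]

theorem digit_eq_div {n k : ℕ} (h : n < M m (k + 1)) : digit m n k = n / M m k :=
  Nat.mod_eq_of_lt (Nat.div_lt_of_lt_mul (by rwa [mul_comm]))

theorem exists_M_le_lt (hm : ∀ k, 2 ≤ m k) {n : ℕ} (hn : 1 ≤ n) :
    ∃ k, M m k ≤ n ∧ n < M m (k + 1) := by
  have hex : ∃ k, n < M m k := ⟨n, lt_M hm n⟩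
  obtain ⟨k, hk⟩ : ∃ k, Nat.find hex = k + 1 := Nat.exists_eq_succ_of_ne_zero fun h0 => by
    have := Nat.find_spec hex
    rw [h0] at this
    simp only [M] at this
    omega
  exact ⟨k, not_lt.1 (Nat.find_min hex (by omega)), hk ▸ Nat.find_spec hex⟩

/-- The index `n` lies in `[M_j, 2 M_j)` exactly when its leading digit is `n_j = 1`. -/
theorem digit_leading_iff (hm : ∀ k, 2 ≤ m k) (n j : ℕ) :
    (M m j ≤ n ∧ n < 2 * M m j) ↔ digit m n j = 1 ∧ ∀ k, j < k → digit m n k = 0 := by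
  have : ∀ k, NeZero (m k) := fun k => ⟨by have := hm k; omega⟩
  constructor
  · rintro ⟨h1, h2⟩
    refine ⟨?_, fun k hk => digit_eq_zero_of_lt (h2.trans_le (two_mul_M_le hm hk))⟩
    rw [digit_eq_div (h2.trans_le (two_mul_M_le hm j.lt_succ_self))]
    exact Nat.div_eq_of_lt_le (by omega) (by omega)
  · rintro ⟨h1, h2⟩
    have hn : 1 ≤ n := by
      rcases Nat.eq_zero_or_pos n with rfl | h
      · simp [digit] at h1
      · exact h
    obtain ⟨k, hk1, hk2⟩ := exists_M_le_lt hm hn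
    have hd : digit m n k = n / M m k := digit_eq_div hk2
    have hpos : 1 ≤ n / M m k := (Nat.one_le_div_iff (M_pos k)).2 hk1
    rcases lt_trichotomy j k with hjk | rfl | hjk
    · have := h2 k hjk
      omega
    · rw [hd] at h1
      have := Nat.lt_mul_of_div_lt (show n / M m j < 2 by omega) (M_pos j)
      exact ⟨hk1, by omega⟩
    · rw [digit_eq_zero_of_lt (hk2.trans_le (M_mono hjk))] at h1
      omega

theorem psi_eq_prod [∀ k, NeZero (m k)] {n K : ℕ} (h : n < M m K) (x : VGroup m) :
    psi m n x = ∏ k ∈ Finset.range K, rademacher m k x ^ digit m n k := by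
  refine finprod_eq_prod_of_mulSupport_subset _ fun k hk => ?_
  by_contra hK
  rw [Finset.mem_coe, Finset.mem_range, not_lt] at hK
  exact hk (by simp [digit_eq_zero_of_lt (h.trans_le (M_mono hK))])

theorem norm_psi [∀ k, NeZero (m k)] (hm : ∀ k, 2 ≤ m k) (n : ℕ) (x : VGroup m) :
    ‖psi m n x‖ = 1 := by
  rw [psi_eq_prod (lt_M hm n), norm_prod]
  exact Finset.prod_eq_one fun k _ => by rw [norm_pow, rademacher_eq, norm_character, one_pow]

theorem digit_M_add {N t i k : ℕ} [∀ k, NeZero (m k)] (htk : t ≤ k) (hkN : k < N)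
    (hi : i < M m t) : digit m (M m N + i) k = 0 := by
  obtain ⟨c, hc⟩ := M_dvd (m := m) (show k + 1 ≤ N from hkN)
  have h : M m N = M m k * (m k * c) := by rw [hc, M]; ring
  rw [digit, h, Nat.mul_add_div (M_pos k), Nat.div_eq_of_lt (hi.trans_le (M_mono htk)), add_zero,
    Nat.mul_mod_right]

/-- On `I_t(0)` the functions `ψ_i`, `M_N ≤ i < M_N + M_t`, all agree with `r_N`. -/
theorem psi_M_add (hm : ∀ k, 2 ≤ m k) {N t i : ℕ} (htN : t ≤ N) (hi : i < M m t)
    {x : VGroup m} (hx : x ∈ interval m t 0) : psi m (M m N + i) x = rademacher m N x := by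
  have : ∀ k, NeZero (m k) := fun k => ⟨by have := hm k; omega⟩
  have hiN : i < M m N := hi.trans_le (M_mono htN)
  obtain ⟨h1, h2⟩ := (digit_leading_iff hm (M m N + i) N).1 ⟨by omega, by omega⟩
  rw [psi, finprod_eq_single _ N, h1, pow_one]
  intro k hk
  rcases lt_or_gt_of_ne hk with hkN | hkN
  · rcases lt_or_ge k t with hkt | hkt
    · rw [rademacher_eq, hx k hkt, Pi.zero_apply, character_zero, one_pow]
    · rw [digit_M_add hkt hkN hi, pow_zero]
  · rw [h2 k hkN, pow_zero]

/-! ### The bump martingale and its coefficients -/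

open scoped Classical in
/-- The function `M_j² r_j` on `I_j(0)`, extended by zero. -/
noncomputable def bump (m : ℕ → ℕ) (j : ℕ) (x : VGroup m) : ℂ :=
  if x ∈ interval m j 0 then (M m j : ℂ) ^ 2 * rademacher m j x else 0

/-- The partial sums of `∑ j, w_j² M_j² r_j 1_{I_j(0)}`. -/
noncomputable def bumpMartingale (m : ℕ → ℕ) (w : ℕ → ℝ) (n : ℕ) (x : VGroup m) : ℂ :=
  ∑ j ∈ Finset.range n, (w j : ℂ) ^ 2 * bump m j x

theorem measurable_psi [∀ k, NeZero (m k)] (hm : ∀ k, 2 ≤ m k) (n : ℕ) : Measurable (psi m n) := by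
  refine (measurable_of_forall_interval (n := n) fun x y hy => ?_).mono (sigmaAlgebra_le m n) le_rfl
  rw [psi_eq_prod (lt_M hm n), psi_eq_prod (lt_M hm n)]
  exact Finset.prod_congr rfl fun k hk => by
    rw [rademacher_eq, rademacher_eq, hy k (Finset.mem_range.1 hk)]

/-- The factor `r_j` reads coordinate `j`, so the bump is `F_{j+1}`-measurable, not
`F_j`-measurable; this is why the `n`-th martingale term stops before `j = n`. -/
theorem bump_eq_of_mem_interval {j n : ℕ} (hj : j < n) {x y : VGroup m}
    (hy : y ∈ interval m n x) : bump m j y = bump m j x := by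
  have h : y ∈ interval m j 0 ↔ x ∈ interval m j 0 :=
    forall₂_congr fun k hk => by rw [hy k (by omega)]
  have hr : rademacher m j y = rademacher m j x := by rw [rademacher_eq, hy j hj, rademacher_eq]
  unfold bump
  split_ifs <;> tauto

theorem measurable_bump (j : ℕ) : Measurable (bump m j) :=
  (measurable_of_forall_interval fun _ _ hy =>
    bump_eq_of_mem_interval j.lt_add_one hy).mono (sigmaAlgebra_le m _) le_rfl

theorem norm_bump_le (j : ℕ) (x : VGroup m) : ‖bump m j x‖ ≤ (M m j : ℝ) ^ 2 := by
  unfold bump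
  split_ifs
  · rw [norm_mul, rademacher_eq, norm_character]
    simp
  · simp

theorem integrable_bump [∀ k, NeZero (m k)] (j : ℕ) : Integrable (bump m j) (haar m) := by
  have := isProbabilityMeasure_haar (m := m)
  exact .of_bound (measurable_bump j).aestronglyMeasurable _ (ae_of_all _ (norm_bump_le j))

theorem integrable_bump_mul_conj_psi [∀ k, NeZero (m k)] (hm : ∀ k, 2 ≤ m k) (j i : ℕ) :
    Integrable (fun x => bump m j x * (starRingEnd ℂ) (psi m i x)) (haar m) := by
  have := isProbabilityMeasure_haar (m := m)
  refine .of_bound ((measurable_bump j).mul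
    (Complex.continuous_conj.measurable.comp (measurable_psi hm i))).aestronglyMeasurable
      ((M m j : ℝ) ^ 2) (ae_of_all _ fun x => ?_)
  rw [norm_mul, RCLike.norm_conj, norm_psi hm, mul_one]
  exact norm_bump_le j x

/-- The integrand factors over coordinates. Those below `j` give `1 / M_j` whatever the digits of
`i`; coordinate `j` forces digit `1`, later ones force digit `0`. By `digit_leading_iff` this is the
stated range. -/
theorem integral_bump_mul_conj_psi [∀ k, NeZero (m k)] (hm : ∀ k, 2 ≤ m k) (j i : ℕ) :
    ∫ x, bump m j x * (starRingEnd ℂ) (psi m i x) ∂haar m =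
      if M m j ≤ i ∧ i < 2 * M m j then (M m j : ℂ) else 0 := by
  classical
  have hM : (M m j : ℂ) ≠ 0 := by exact_mod_cast (M_pos j).ne'
  have hmk : ∀ k, (m k : ℂ) ≠ 0 := fun k => by exact_mod_cast NeZero.ne (m k)
  set d := digit m i with hd
  let g : ∀ k, ZMod (m k) → ℂ := fun k z =>
    if k < j then (if z = 0 then 1 else 0)
    else if k = j then character (m k) z * (starRingEnd ℂ) (character (m k) z ^ d k)
    else (starRingEnd ℂ) (character (m k) z ^ d k)
  -- Large enough to cover coordinate `j` and every nonzero digit of `i`.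
  set K := i + j + 1 with hK
  have hKi : i < M m K := (lt_M hm i).trans_le (M_mono (by omega))
  have hprod : ∀ x, bump m j x * (starRingEnd ℂ) (psi m i x) =
      (M m j : ℂ) ^ 2 * ∏ k ∈ Finset.range K, g k (x k) := by
    intro x
    by_cases hx : x ∈ interval m j 0
    · rw [bump, if_pos hx, psi_eq_prod hKi, map_prod, mul_assoc]
      congr 1
      rw [← Finset.mul_prod_erase _ _ (show j ∈ Finset.range K by simp; omega),
        ← Finset.mul_prod_erase _ _ (show j ∈ Finset.range K by simp; omega), ← mul_assoc]
      congr 1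
      · simp [g, rademacher_eq, hd]
      · refine Finset.prod_congr rfl fun k hk => ?_
        have hkj := Finset.ne_of_mem_erase hk
        simp only [g, rademacher_eq, if_neg hkj]
        split_ifs with h1 h2
        · simp [h2, character_zero]
        · exact absurd (hx k h1) h2
        · rfl
    · have hx' : ∃ k < j, x k ≠ 0 := by
        simpa [interval] using hx
      obtain ⟨k, hkj, hk⟩ := hx'
      rw [bump, if_neg hx, zero_mul, Finset.prod_eq_zero (i := k) (by simp; omega) (by
        simp [g, hkj, hk]), mul_zero]
  have hint : ∀ k, (m k : ℂ)⁻¹ * ∑ z, g k z =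
      if k < j then (m k : ℂ)⁻¹ else if k = j then (if d k = 1 then 1 else 0)
      else if d k = 0 then 1 else 0 := by
    intro k
    simp only [g]
    split_ifs with h1 h2 h3 h3
    · simp
    · rw [sum_character_mul_conj (hm k) (digit_lt i k), if_pos h3, inv_mul_cancel₀ (hmk k)]
    · rw [sum_character_mul_conj (hm k) (digit_lt i k), if_neg h3, mul_zero]
    · rw [sum_conj_character_pow (digit_lt i k), if_pos h3, inv_mul_cancel₀ (hmk k)]
    · rw [sum_conj_character_pow (digit_lt i k), if_neg h3, mul_zero]
  simp only [hprod]
  rw [integral_const_mul, integral_prod_haar]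
  simp only [hint, digit_leading_iff hm]
  split_ifs with h
  · obtain ⟨h1, h2⟩ := h
    have : ∏ k ∈ Finset.range j, (m k : ℂ)⁻¹ = (M m j : ℂ)⁻¹ := by
      rw [M_eq_prod, Nat.cast_prod, Finset.prod_inv_distrib]
    rw [← Finset.prod_subset (Finset.range_mono (show j ≤ K by omega)),
      Finset.prod_congr rfl fun k hk => if_pos (Finset.mem_range.1 hk), this]
    · field_simp
    · intro k _ hk
      rw [Finset.mem_range] at hk
      rw [if_neg hk]
      split_ifs with h3 h4 h4
      · rfl
      · exact absurd (h3 ▸ h1) h4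
      · rfl
      · exact absurd (h2 k (by omega)) h4
  · by_cases h1 : d j = 1
    · obtain ⟨k, hk, hdk⟩ : ∃ k, j < k ∧ d k ≠ 0 := by
        by_contra hcon
        push Not at hcon
        exact h ⟨h1, hcon⟩
      have hkK : k < K := by
        by_contra hkK
        exact hdk (digit_eq_zero_of_lt (hKi.trans_le (M_mono (not_lt.1 hkK))))
      rw [Finset.prod_eq_zero (Finset.mem_range.2 hkK), mul_zero]
      simp [hk.not_gt, hk.ne', hdk]
    · rw [Finset.prod_eq_zero (i := j) (by simp; omega), mul_zero]
      simp [h1]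

theorem integral_bump [∀ k, NeZero (m k)] (hm : ∀ k, 2 ≤ m k) (j : ℕ) :
    ∫ x, bump m j x ∂haar m = 0 := by
  have h := integral_bump_mul_conj_psi hm j 0
  have h1 : ∀ x, psi m 0 x = 1 := fun x => by simp [psi, digit]
  rw [if_neg (by have := M_pos (m := m) j; omega)] at h
  simpa [h1] using h

/-- The increment at time `n` has mean zero and lives on the single atom `I_n(0)` of `F_n`, so it
integrates to zero over every set of `F_n`. -/
theorem martingale_bumpMartingale [∀ k, NeZero (m k)] (hm : ∀ k, 2 ≤ m k) (w : ℕ → ℝ) :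
    Martingale (bumpMartingale m w) (filtration m) (haar m) := by
  have := isProbabilityMeasure_haar (m := m)
  have hmeas : ∀ n, Measurable[sigmaAlgebra m n] (bumpMartingale m w n) := fun n => by
    refine measurable_of_forall_interval fun x y hy => Finset.sum_congr rfl fun j hj => ?_
    rw [bump_eq_of_mem_interval (Finset.mem_range.1 hj) hy]
  have hint : ∀ n, Integrable (bumpMartingale m w n) (haar m) := fun n =>
    integrable_finsetSum _ fun j _ => (integrable_bump j).const_mul _
  refine martingale_nat (fun n => (hmeas n).stronglyMeasurable) hint fun n => ?_
  refine ae_eq_condExp_of_forall_setIntegral_eq ((filtration m).le n) (hint _)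
    (fun s _ _ => (hint n).integrableOn) (fun s hs _ => ?_)
    (hmeas n).stronglyMeasurable.aestronglyMeasurable
  have hbump : ∫ x in s, bump m n x ∂haar m = 0 := by
    rw [← integral_indicator (sigmaAlgebra_le m n _ hs)]
    rcases interval_subset_or_disjoint 0 hs with h | h
    · rw [Set.indicator_eq_self.2, integral_bump hm]
      intro x hx
      by_contra hxs
      exact hx (if_neg fun hxi => hxs (h hxi))
    · rw [Set.indicator_eq_zero'.2, integral_zero']
      refine Set.disjoint_left.2 fun x hx hxs => hx (if_neg fun hxi => h hxi hxs)
  have hsucc : bumpMartingale m w (n + 1) =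
      fun x => bumpMartingale m w n x + (w n : ℂ) ^ 2 * bump m n x :=
    funext fun x => Finset.sum_range_succ _ n
  rw [hsucc, integral_add (hint n).integrableOn ((integrable_bump n).const_mul _).integrableOn,
    integral_const_mul, hbump, mul_zero, add_zero]

/-- The defining limit is eventually constant: bumps with `j ≥ n` only carry frequencies at least
`M_n > i`. -/
theorem vilenkinCoeff_bumpMartingale [∀ k, NeZero (m k)] (hm : ∀ k, 2 ≤ m k) (w : ℕ → ℝ) {i n : ℕ}
    (hi : i < M m n) :
    vilenkinCoeff m (bumpMartingale m w) i = ∑ j ∈ Finset.range n,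
      (w j : ℂ) ^ 2 * if M m j ≤ i ∧ i < 2 * M m j then (M m j : ℂ) else 0 := by
  refine Tendsto.limUnder_eq (tendsto_const_nhds.congr' ?_)
  filter_upwards [eventually_ge_atTop n] with k hk
  simp only [bumpMartingale, Finset.sum_mul, mul_assoc]
  rw [integral_finsetSum _ fun j _ => (integrable_bump_mul_conj_psi hm j i).const_mul _]
  simp only [integral_const_mul, integral_bump_mul_conj_psi hm]
  refine Finset.sum_subset (Finset.range_mono hk) fun j _ hj => ?_
  have := M_mono (m := m) (not_lt.1 (Finset.mem_range.not.1 hj))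
  rw [if_neg (by omega), mul_zero]

/-! ### The maximal function -/

/-- A sum of squares of nonnegative terms is at most the square of their sum. The bound is
independent of `n`, and its square root is linear in `w`. -/
theorem enorm_bumpMartingale_le {w : ℕ → ℝ} (hw : ∀ j, 0 ≤ w j) (n : ℕ) (x : VGroup m) :
    ‖bumpMartingale m w n x‖ₑ ≤ (∑' j, (interval m j 0).indicator
      (fun _ => ENNReal.ofReal (w j) * (M m j : ℝ≥0∞)) x) ^ (2 : ℕ) := by
  set u : ℕ → ℝ≥0∞ := fun j => (interval m j 0).indicator
      (fun _ => ENNReal.ofReal (w j) * (M m j : ℝ≥0∞)) x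
  have hterm : ∀ j, ‖(w j : ℂ) ^ 2 * bump m j x‖ₑ ≤ u j ^ 2 := by
    intro j
    by_cases hx : x ∈ interval m j 0
    · have : u j = ENNReal.ofReal (w j * M m j) := by
        simp only [u, Set.indicator_of_mem hx]
        rw [ENNReal.ofReal_mul (hw j), ENNReal.ofReal_natCast]
      rw [this, ← ENNReal.ofReal_pow (by have := hw j; positivity), ← ofReal_norm]
      refine ENNReal.ofReal_le_ofReal ?_
      rw [norm_mul, norm_pow, Complex.norm_real, Real.norm_eq_abs, sq_abs, mul_pow]
      exact mul_le_mul_of_nonneg_left (norm_bump_le j x) (sq_nonneg _)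
    · simp [bump, hx]
  calc ‖bumpMartingale m w n x‖ₑ ≤ ∑ j ∈ Finset.range n, ‖(w j : ℂ) ^ 2 * bump m j x‖ₑ :=
        enorm_sum_le _ _
    _ ≤ ∑ j ∈ Finset.range n, u j * ∑' i, u i :=
        Finset.sum_le_sum fun j _ => (hterm j).trans (by
          rw [sq]; exact mul_le_mul_right (ENNReal.le_tsum j) _)
    _ = (∑ j ∈ Finset.range n, u j) * ∑' i, u i := by rw [Finset.sum_mul]
    _ ≤ (∑' i, u i) ^ 2 := by
        rw [sq]; exact mul_le_mul_left (ENNReal.sum_le_tsum _) _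

theorem lintegral_sqrt_maximalFunction_le [∀ k, NeZero (m k)] {w : ℕ → ℝ} (hw : ∀ j, 0 ≤ w j) :
    ∫⁻ x, maximalFunction m (bumpMartingale m w) x ^ (1 / 2 : ℝ) ∂haar m ≤
      ∑' j, ENNReal.ofReal (w j) := by
  calc ∫⁻ x, maximalFunction m (bumpMartingale m w) x ^ (1 / 2 : ℝ) ∂haar m
      ≤ ∫⁻ x, ∑' j, (interval m j 0).indicator
        (fun _ => ENNReal.ofReal (w j) * (M m j : ℝ≥0∞)) x ∂haar m := by
        refine lintegral_mono fun x => ?_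
        rw [one_div, ENNReal.rpow_inv_le_iff (by norm_num)]
        refine iSup_le fun n => (enorm_bumpMartingale_le hw n x).trans_eq ?_
        rw [← ENNReal.rpow_natCast, Nat.cast_ofNat]
    _ = ∑' j, ENNReal.ofReal (w j) := by
        rw [lintegral_tsum fun j => (measurable_const.indicator
          (measurableSet_interval j 0)).aemeasurable]
        refine tsum_congr fun j => ?_
        rw [lintegral_indicator_const (measurableSet_interval j 0), haar_interval_zero, mul_assoc,
          ENNReal.mul_inv_cancel, mul_one]
        · exact_mod_cast (M_pos j).ne'
        · simp

theorem memHardy_bumpMartingale (hm : ∀ k, 2 ≤ m k) {w : ℕ → ℝ} (hw : ∀ j, 0 ≤ w j)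
    (hws : Summable w) : MemHardy m (1 / 2) (bumpMartingale m w) := by
  have : ∀ k, NeZero (m k) := fun k => ⟨by have := hm k; omega⟩
  refine ⟨martingale_bumpMartingale hm w, ?_⟩
  rw [eLpNorm_lt_top_iff_lintegral_rpow_enorm_lt_top (by simp) (by simp)]
  have h2 : ((1 : ℝ≥0∞) / 2).toReal = 1 / 2 := by simp
  simp only [h2, enorm_eq_self]
  exact (lintegral_sqrt_maximalFunction_le hw).trans_lt hws.tsum_ofReal_lt_top

/-! ### Lower bounds for the Fejér means -/

theorem vilenkinCoeff_leading (hm : ∀ k, 2 ≤ m k) (w : ℕ → ℝ) {i N : ℕ}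
    (hi : M m N ≤ i) (hi' : i < 2 * M m N) :
    vilenkinCoeff m (bumpMartingale m w) i = (w N : ℂ) ^ 2 * M m N := by
  have : ∀ k, NeZero (m k) := fun k => ⟨by have := hm k; omega⟩
  rw [vilenkinCoeff_bumpMartingale hm w (hi'.trans_le (two_mul_M_le hm N.lt_add_one)),
    Finset.sum_range_succ, if_pos ⟨hi, hi'⟩, Finset.sum_eq_zero, zero_add]
  intro j hj
  have := two_mul_M_le hm (Finset.mem_range.1 hj)
  rw [if_neg (by omega), mul_zero]

/-- Bump `j` occupies `M_j` frequencies, each with coefficient `w_j² M_j`. -/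
theorem sum_norm_vilenkinCoeff_le (hm : ∀ k, 2 ≤ m k) (w : ℕ → ℝ) (N : ℕ) :
    ∑ i ∈ Finset.range (M m N), ‖vilenkinCoeff m (bumpMartingale m w) i‖ ≤
      ∑ j ∈ Finset.range N, (w j * M m j) ^ 2 := by
  have : ∀ k, NeZero (m k) := fun k => ⟨by have := hm k; omega⟩
  calc ∑ i ∈ Finset.range (M m N), ‖vilenkinCoeff m (bumpMartingale m w) i‖
      ≤ ∑ i ∈ Finset.range (M m N), ∑ j ∈ Finset.range N,
          w j ^ 2 * if i ∈ Finset.Ico (M m j) (2 * M m j) then (M m j : ℝ) else 0 := by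
        refine Finset.sum_le_sum fun i hi => ?_
        rw [vilenkinCoeff_bumpMartingale hm w (Finset.mem_range.1 hi)]
        refine (norm_sum_le _ _).trans_eq (Finset.sum_congr rfl fun j _ => ?_)
        rw [norm_mul, norm_pow, Complex.norm_real, Real.norm_eq_abs, sq_abs]
        simp only [Finset.mem_Ico]
        split_ifs <;> simp
    _ = ∑ j ∈ Finset.range N, w j ^ 2 * ∑ i ∈ Finset.range (M m N),
          if i ∈ Finset.Ico (M m j) (2 * M m j) then (M m j : ℝ) else 0 := by
        rw [Finset.sum_comm]
        simp only [Finset.mul_sum]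
    _ ≤ ∑ j ∈ Finset.range N, (w j * M m j) ^ 2 := by
        refine Finset.sum_le_sum fun j _ => ?_
        rw [mul_pow]
        refine mul_le_mul_of_nonneg_left ?_ (sq_nonneg _)
        rw [← Finset.sum_filter, Finset.sum_const, nsmul_eq_mul, sq]
        refine mul_le_mul_of_nonneg_right ?_ (Nat.cast_nonneg _)
        rw [Finset.filter_mem_eq_inter]
        refine Nat.cast_le.2 ((Finset.card_le_card Finset.inter_subset_right).trans_eq ?_)
        rw [Nat.card_Ico]
        omega

theorem norm_partialSum_le (hm : ∀ k, 2 ≤ m k) (w : ℕ → ℝ) {l N : ℕ} (hl : l ≤ M m N)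
    (x : VGroup m) :
    ‖partialSum m (bumpMartingale m w) l x‖ ≤ ∑ j ∈ Finset.range N, (w j * M m j) ^ 2 := by
  have : ∀ k, NeZero (m k) := fun k => ⟨by have := hm k; omega⟩
  refine (norm_sum_le _ _).trans (le_trans ?_ (sum_norm_vilenkinCoeff_le hm w N))
  simp only [norm_mul, norm_psi hm, mul_one]
  exact Finset.sum_le_sum_of_subset_of_nonneg (Finset.range_mono hl) fun _ _ _ => norm_nonneg _

theorem partialSum_M_add (hm : ∀ k, 2 ≤ m k) (w : ℕ → ℝ) {N t l : ℕ} (htN : t ≤ N)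
    (hl : l ≤ M m t) {x : VGroup m} (hx : x ∈ interval m t 0) :
    partialSum m (bumpMartingale m w) (M m N + l) x =
      partialSum m (bumpMartingale m w) (M m N) x +
        l * ((w N : ℂ) ^ 2 * M m N * rademacher m N x) := by
  have : ∀ k, NeZero (m k) := fun k => ⟨by have := hm k; omega⟩
  have htN' := M_mono (m := m) htN
  rw [partialSum, Finset.sum_range_add, partialSum]
  congr 1
  rw [Finset.sum_congr rfl fun i hi => ?_, Finset.sum_const, Finset.card_range, nsmul_eq_mul]
  rw [Finset.mem_range] at hi
  rw [vilenkinCoeff_leading hm w (N := N) (by omega) (by omega), psi_M_add hm htN (by omega) hx]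

/-- The linear growth in `partialSum_M_add` sums to `M_t (M_t - 1) / 2` copies of `w_N² M_N r_N`;
everything else consists of `M_N + M_t` partial sums of order at most `M_N`, which average to at
most the subtracted error. -/
theorem norm_fejer_ge (hm : ∀ k, 2 ≤ m k) (w : ℕ → ℝ) {N t : ℕ} (ht : 1 ≤ t) (htN : t ≤ N)
    {x : VGroup m} (hx : x ∈ interval m t 0) :
    (w N * M m t) ^ 2 / 8 - ∑ j ∈ Finset.range N, (w j * M m j) ^ 2 ≤
      ‖fejer m (bumpMartingale m w) (M m N + M m t) x‖ := by
  have : ∀ k, NeZero (m k) := fun k => ⟨by have := hm k; omega⟩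
  set C := ∑ j ∈ Finset.range N, (w j * M m j) ^ 2 with hC
  set S := partialSum m (bumpMartingale m w) with hS
  set z : ℂ := (w N : ℂ) ^ 2 * M m N * rademacher m N x with hz
  have hC0 : 0 ≤ C := Finset.sum_nonneg fun _ _ => sq_nonneg _
  have htN' : (M m t : ℝ) ≤ M m N := by exact_mod_cast M_mono (m := m) htN
  have hMt : (2 : ℝ) ≤ M m t := by
    exact_mod_cast (show 2 ≤ M m t by simpa [M] using two_mul_M_le hm (show 0 < t by omega))
  have hznorm : ‖z‖ = w N ^ 2 * M m N := by
    rw [hz, norm_mul, norm_mul, rademacher_eq, norm_character, norm_pow, Complex.norm_real,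
      Real.norm_eq_abs, sq_abs]
    simp
  have hgauss : ∑ l ∈ Finset.range (M m t), (l : ℂ) =
      ((M m t * (M m t - 1) / 2 : ℝ) : ℂ) := by
    have h : ∀ n : ℕ, ∑ l ∈ Finset.range n, (l : ℂ) = ((n * (n - 1) / 2 : ℝ) : ℂ) := by
      intro n
      induction n with
      | zero => simp
      | succ n ih => rw [Finset.sum_range_succ, ih]; push_cast; ring
    exact h _
  have hdecomp : ∑ k ∈ Finset.range (M m N + M m t), S k x =
      (∑ k ∈ Finset.range (M m N), S k x + M m t * S (M m N) x) +
        ((M m t * (M m t - 1) / 2 : ℝ) : ℂ) * z := by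
    rw [Finset.sum_range_add, Finset.sum_congr rfl fun l hl =>
      partialSum_M_add hm w htN (Finset.mem_range.1 hl).le hx, Finset.sum_add_distrib,
      Finset.sum_const, Finset.card_range, nsmul_eq_mul, ← Finset.sum_mul, hgauss, add_assoc]
  have hlow : ‖∑ k ∈ Finset.range (M m N), S k x + M m t * S (M m N) x‖ ≤
      (M m N + M m t) * C := by
    refine (norm_add_le _ _).trans ?_
    rw [add_mul]
    refine add_le_add ?_ ?_
    · refine (norm_sum_le_of_le _ fun k hk =>
        norm_partialSum_le hm w (Finset.mem_range.1 hk).le x).trans_eq ?_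
      simp [hC]
    · rw [norm_mul, Complex.norm_natCast]
      exact mul_le_mul_of_nonneg_left (norm_partialSum_le hm w le_rfl x) (Nat.cast_nonneg _)
  have hhigh : ‖((M m t * (M m t - 1) / 2 : ℝ) : ℂ) * z‖ =
      (M m t * (M m t - 1) / 2) * (w N ^ 2 * M m N) := by
    rw [norm_mul, hznorm, Complex.norm_real, Real.norm_of_nonneg]
    have : (0 : ℝ) ≤ M m t - 1 := by linarith
    positivity
  have htri : ‖((M m t * (M m t - 1) / 2 : ℝ) : ℂ) * z‖ -
      ‖∑ k ∈ Finset.range (M m N), S k x + M m t * S (M m N) x‖ ≤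
        ‖∑ k ∈ Finset.range (M m N + M m t), S k x‖ := by
    rw [hdecomp, add_comm (∑ k ∈ Finset.range (M m N), S k x + M m t * S (M m N) x)]
    exact norm_sub_le_norm_add _ _
  have hpos : (0 : ℝ) < M m N + M m t := by linarith
  rw [fejer, norm_mul, norm_div, norm_one, Complex.norm_natCast, Nat.cast_add, one_div_mul_eq_div,
    le_div_iff₀ hpos]
  refine le_trans ?_ htri
  rw [hhigh]
  -- The `8` collects three factors of two: the Gauss sum, `M_t - 1 ≥ M_t / 2` (from `t ≥ 1`), and
  -- `M_N + M_t ≤ 2 M_N`.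
  have hkey : (w N * M m t) ^ 2 / 8 * (M m N + M m t) ≤
      (M m t * (M m t - 1) / 2) * (w N ^ 2 * M m N) := by
    calc (w N * M m t) ^ 2 / 8 * (M m N + M m t)
        ≤ (w N * M m t) ^ 2 / 8 * (2 * M m N) :=
          mul_le_mul_of_nonneg_left (by linarith) (by positivity)
      _ = (M m t * (M m t / 2) / 2) * (w N ^ 2 * M m N) := by ring
      _ ≤ _ := mul_le_mul_of_nonneg_right (by nlinarith) (by positivity)
  linarith

theorem sqrt_maximalFejer_add_ge (hm : ∀ k, 2 ≤ m k) {w : ℕ → ℝ} (hw : ∀ j, 0 ≤ w j) {N t : ℕ}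
    (ht : 1 ≤ t) (htN : t ≤ N) {x : VGroup m} (hx : x ∈ interval m t 0) :
    ENNReal.ofReal (w N * M m t / 3) ≤ maximalFejer m (bumpMartingale m w) x ^ (1 / 2 : ℝ) +
      ENNReal.ofReal (∑ j ∈ Finset.range N, w j * M m j) := by
  have : ∀ k, NeZero (m k) := fun k => ⟨by have := hm k; omega⟩
  have hw' : ∀ j, 0 ≤ w j * M m j := fun j => mul_nonneg (hw j) (Nat.cast_nonneg _)
  set D := ∑ j ∈ Finset.range N, w j * M m j with hD
  have hD0 : 0 ≤ D := Finset.sum_nonneg fun j _ => hw' j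
  set σ := ‖fejer m (bumpMartingale m w) (M m N + M m t) x‖ with hσ
  have hsq : ∑ j ∈ Finset.range N, (w j * M m j) ^ 2 ≤ D ^ 2 := by
    rw [sq D, hD, Finset.sum_mul]
    refine Finset.sum_le_sum fun j hj => ?_
    rw [sq]
    exact mul_le_mul_of_nonneg_left (Finset.single_le_sum
      (f := fun j => w j * (M m j : ℝ)) (fun j _ => hw' j) hj) (hw' j)
  have hge := norm_fejer_ge hm w ht htN hx
  -- Squaring suffices, since `1 / 9 ≤ 1 / 8` and `σ + D² ≤ (√σ + D)²`.
  have hreal : w N * M m t / 3 ≤ √σ + D := by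
    refine le_of_sq_le_sq ?_ (by positivity)
    have h1 : √σ ^ 2 = σ := Real.sq_sqrt (norm_nonneg _)
    have h2 : 0 ≤ √σ * D := by positivity
    nlinarith [sq_nonneg (w N * M m t)]
  have hsup : ENNReal.ofReal (√σ) ≤ maximalFejer m (bumpMartingale m w) x ^ (1 / 2 : ℝ) := by
    rw [Real.sqrt_eq_rpow, ← ENNReal.ofReal_rpow_of_nonneg (norm_nonneg _) (by norm_num),
      ofReal_norm]
    refine ENNReal.rpow_le_rpow ?_ (by norm_num)
    exact le_iSup₂_of_le (M m N + M m t) (by have := M_pos (m := m) N; omega) le_rfl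
  refine (ENNReal.ofReal_le_ofReal hreal).trans ?_
  rw [ENNReal.ofReal_add (Real.sqrt_nonneg _) hD0]
  exact add_le_add_left hsup _

theorem haar_interval_diff_ge (hm : ∀ k, 2 ≤ m k) (t : ℕ) :
    ENNReal.ofReal (1 / (2 * M m t)) ≤ haar m (interval m t 0 \ interval m (t + 1) 0) := by
  have : ∀ k, NeZero (m k) := fun k => ⟨by have := hm k; omega⟩
  have := isProbabilityMeasure_haar (m := m)
  have h0 : ∀ n, (0 : ℝ) < M m n := fun n => by exact_mod_cast M_pos n
  have hinv : ∀ n, (M m n : ℝ≥0∞)⁻¹ = ENNReal.ofReal (M m n : ℝ)⁻¹ := fun n => by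
    rw [ENNReal.ofReal_inv_of_pos (h0 n), ENNReal.ofReal_natCast]
  rw [measure_sdiff (show interval m (t + 1) 0 ⊆ interval m t 0 from
      fun y hy k hk => hy k (by omega))
    (measurableSet_interval _ _).nullMeasurableSet (measure_ne_top _ _), haar_interval_zero,
    haar_interval_zero, hinv, hinv, ← ENNReal.ofReal_sub _ (inv_nonneg.2 (h0 _).le)]
  refine ENNReal.ofReal_le_ofReal ?_
  have h2 : (2 * M m t : ℝ) ≤ M m (t + 1) := by
    exact_mod_cast two_mul_M_le hm t.lt_add_one
  have h3 : (M m (t + 1) : ℝ)⁻¹ ≤ (2 * M m t : ℝ)⁻¹ :=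
    inv_anti₀ (by have := h0 t; positivity) h2
  have h4 : (M m t : ℝ)⁻¹ = 2 * (2 * M m t : ℝ)⁻¹ := by
    have := h0 t
    field_simp
  rw [one_div]
  linarith

/-- On each layer the height `w_{N+1} M_t / 3` compensates the measure `1 / (2 M_t)`. The layers are
disjoint, so the error is paid once rather than `N` times. -/
theorem lintegral_sqrt_maximalFejer_ge (hm : ∀ k, 2 ≤ m k) {w : ℕ → ℝ} (hw : ∀ j, 0 ≤ w j)
    (N : ℕ) :
    ENNReal.ofReal (N * (w (N + 1) / 6)) ≤
      ∫⁻ x, maximalFejer m (bumpMartingale m w) x ^ (1 / 2 : ℝ) ∂haar m +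
        ENNReal.ofReal (∑ j ∈ Finset.range (N + 1), w j * M m j) := by
  have : ∀ k, NeZero (m k) := fun k => ⟨by have := hm k; omega⟩
  have := isProbabilityMeasure_haar (m := m)
  set D := ENNReal.ofReal (∑ j ∈ Finset.range (N + 1), w j * M m j)
  -- The shift skips `I_0(0)`, since the Fejér bound needs depth at least `1`.
  let A : ℕ → Set (VGroup m) := fun t => interval m (t + 1) 0 \ interval m (t + 2) 0
  have hA : ∀ t, MeasurableSet (A t) := fun t =>
    (measurableSet_interval _ _).diff (measurableSet_interval _ _)
  have hdisj : ∀ s t, s < t → Disjoint (A s) (A t) := fun s t hst =>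
    Set.disjoint_left.2 fun x hxs hxt => hxs.2 fun k hk => hxt.1 k (by omega)
  have hterm : ∀ t ∈ Finset.range N, ENNReal.ofReal (w (N + 1) / 6) ≤
      ∫⁻ x in A t, (maximalFejer m (bumpMartingale m w) x ^ (1 / 2 : ℝ) + D) ∂haar m := by
    intro t ht
    rw [Finset.mem_range] at ht
    have h0 : (0 : ℝ) < M m (t + 1) := by exact_mod_cast M_pos (t + 1)
    calc ENNReal.ofReal (w (N + 1) / 6)
        = ENNReal.ofReal (w (N + 1) * M m (t + 1) / 3) *
            ENNReal.ofReal (1 / (2 * M m (t + 1))) := by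
          rw [← ENNReal.ofReal_mul (by have := hw (N + 1); positivity)]
          congr 1
          field_simp
          ring
      _ ≤ ENNReal.ofReal (w (N + 1) * M m (t + 1) / 3) * haar m (A t) :=
          mul_le_mul_right (haar_interval_diff_ge hm (t + 1)) _
      _ = ∫⁻ _ in A t, ENNReal.ofReal (w (N + 1) * M m (t + 1) / 3) ∂haar m := by
          rw [setLIntegral_const]
      _ ≤ _ := setLIntegral_mono' (hA t) fun x hx =>
          sqrt_maximalFejer_add_ge hm hw (by omega) (by omega) hx.1
  calc ENNReal.ofReal (N * (w (N + 1) / 6))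
      = ∑ t ∈ Finset.range N, ENNReal.ofReal (w (N + 1) / 6) := by
        rw [Finset.sum_const, Finset.card_range, nsmul_eq_mul,
          ENNReal.ofReal_mul (Nat.cast_nonneg _), ENNReal.ofReal_natCast]
    _ ≤ ∑ t ∈ Finset.range N,
        ∫⁻ x in A t, (maximalFejer m (bumpMartingale m w) x ^ (1 / 2 : ℝ) + D) ∂haar m :=
        Finset.sum_le_sum hterm
    _ = ∫⁻ x in ⋃ t ∈ Finset.range N, A t,
          (maximalFejer m (bumpMartingale m w) x ^ (1 / 2 : ℝ) + D) ∂haar m := by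
        refine (lintegral_biUnion_finset (fun s _ t _ hst => ?_) (fun t _ => hA t) _).symm
        rcases lt_or_gt_of_ne hst with h | h
        · exact hdisj s t h
        · exact (hdisj t s h).symm
    _ ≤ ∫⁻ x, (maximalFejer m (bumpMartingale m w) x ^ (1 / 2 : ℝ) + D) ∂haar m :=
        setLIntegral_le_lintegral _ _
    _ = _ := by
        rw [lintegral_add_right _ measurable_const, lintegral_const, measure_univ, mul_one]

/-! ### Lacunary weights -/

/-- Put weight `2^{-k}` at position `A k` and zero elsewhere. The error before `A (k + 1)` involves
only indices up to `A k`, so `A (k + 1)` can then be taken as large as needed. -/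
theorem exists_lacunary_weights {b : ℕ → ℝ} (hb : ∀ j, 0 ≤ b j) :
    ∃ w : ℕ → ℝ, (∀ j, 0 ≤ w j) ∧ Summable w ∧ ∀ R : ℝ, ∃ N : ℕ,
      R + ∑ j ∈ Finset.range (N + 1), w j * b j ≤ N * (w (N + 1) / 6) := by
  -- With `a = A k` and `c = A (k + 1)`: bounding the weights by `1` lets the gap be chosen before
  -- `w` is defined, and `c - 1` is the eventual `N`.
  have hex : ∀ k a : ℕ, ∃ c : ℕ, a < c ∧
      (k : ℝ) + ∑ j ∈ Finset.range (a + 1), b j ≤ (c - 1 : ℕ) * ((1 / 2 : ℝ) ^ (k + 1) / 6) := by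
    intro k a
    obtain ⟨n, hn⟩ := exists_nat_ge
      (((k : ℝ) + ∑ j ∈ Finset.range (a + 1), b j) / ((1 / 2 : ℝ) ^ (k + 1) / 6))
    refine ⟨a + n + 1, by omega, ?_⟩
    rw [div_le_iff₀ (by positivity)] at hn
    refine hn.trans (mul_le_mul_of_nonneg_right (Nat.cast_le.2 (by omega)) (by positivity))
  choose next hnext hbound using hex
  obtain ⟨A, hAsucc⟩ : ∃ A : ℕ → ℕ, ∀ k, A (k + 1) = next k (A k) :=
    ⟨fun k => Nat.rec 0 next k, fun _ => rfl⟩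
  have hAmono : StrictMono A := strictMono_nat_of_lt_succ fun k => hAsucc k ▸ hnext k (A k)
  obtain ⟨w, hwA, hwne⟩ : ∃ w : ℕ → ℝ, (∀ k, w (A k) = (1 / 2 : ℝ) ^ k) ∧
      ∀ j, (∀ k, A k ≠ j) → w j = 0 :=
    ⟨Function.extend A (fun k => (1 / 2 : ℝ) ^ k) 0, fun k => hAmono.injective.extend_apply _ _ _,
      fun j hj => Function.extend_apply' _ _ _ (by simpa using hj)⟩
  have hw01 : ∀ j, 0 ≤ w j ∧ w j ≤ 1 := by
    intro j
    by_cases hj : ∃ k, A k = j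
    · obtain ⟨k, rfl⟩ := hj
      rw [hwA]
      exact ⟨by positivity, pow_le_one₀ (by norm_num) (by norm_num)⟩
    · rw [hwne j (by simpa using hj)]
      norm_num
  refine ⟨w, fun j => (hw01 j).1, ?_, fun R => ?_⟩
  · rw [← hAmono.injective.summable_iff fun j hj => hwne j (by simpa using hj)]
    exact summable_geometric_two.congr fun k => (hwA k).symm
  · obtain ⟨k, hk⟩ := exists_nat_ge R
    refine ⟨A (k + 1) - 1, ?_⟩
    have hpos : A (k + 1) - 1 + 1 = A (k + 1) := by
      have := hAmono k.lt_add_one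
      omega
    rw [hpos, hwA]
    refine le_trans (add_le_add hk ?_) (hAsucc k ▸ hbound k (A k))
    calc ∑ j ∈ Finset.range (A (k + 1)), w j * b j
        = ∑ j ∈ Finset.range (A k + 1), w j * b j := by
          refine (Finset.sum_subset (Finset.range_mono (hAmono k.lt_add_one)) ?_).symm
          intro j hj1 hj2
          rw [Finset.mem_range] at hj1 hj2
          rw [hwne j, zero_mul]
          rintro i rfl
          have := hAmono.lt_iff_lt.1 hj1
          have := hAmono.monotone (show i ≤ k by omega)
          omega
      _ ≤ ∑ j ∈ Finset.range (A k + 1), b j :=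
          Finset.sum_le_sum fun j _ => mul_le_of_le_one_left (hb j) (hw01 j).2

end Vilenkin

theorem corollary1 (m : ℕ → ℕ) (hm : ∀ k, 2 ≤ m k) (hbdd : BddAbove (Set.range m)) :
    ∃ f : ℕ → Vilenkin.VGroup m → ℂ,
      Vilenkin.MemHardy m (1 / 2) f ∧
        MeasureTheory.eLpNorm (Vilenkin.maximalFejer m f) (1 / 2) (Vilenkin.haar m) = ⊤ := by
  obtain ⟨w, hw, hws, hlarge⟩ :=
    Vilenkin.exists_lacunary_weights (b := fun j => (Vilenkin.M m j : ℝ)) fun j => Nat.cast_nonneg _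
  refine ⟨Vilenkin.bumpMartingale m w, Vilenkin.memHardy_bumpMartingale hm hw hws, ?_⟩
  have h2 : ((1 : ℝ≥0∞) / 2).toReal = 1 / 2 := by simp
  by_contra hne
  have hfin := (eLpNorm_lt_top_iff_lintegral_rpow_enorm_lt_top (by simp) (by simp)).1
    (lt_top_iff_ne_top.2 hne)
  simp only [h2, enorm_eq_self] at hfin
  set I := ∫⁻ x, Vilenkin.maximalFejer m (Vilenkin.bumpMartingale m w) x ^ (1 / 2 : ℝ)
    ∂Vilenkin.haar m
  -- The extra `1` makes the lower bound strictly exceed the supposedly finite integral.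
  obtain ⟨N, hN⟩ := hlarge (I.toReal + 1)
  have hge := Vilenkin.lintegral_sqrt_maximalFejer_ge hm hw N
  have hD : 0 ≤ ∑ j ∈ Finset.range (N + 1), w j * (Vilenkin.M m j : ℝ) :=
    Finset.sum_nonneg fun j _ => mul_nonneg (hw j) (Nat.cast_nonneg _)
  change _ ≤ I + _ at hge
  rw [← ENNReal.ofReal_toReal hfin.ne, ← ENNReal.ofReal_add ENNReal.toReal_nonneg hD,
    ENNReal.ofReal_le_ofReal_iff (add_nonneg ENNReal.toReal_nonneg hD)] at hge
  linarith
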